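/- **Theorem (Realized dilation germ from a 1-jet of contact scale).** Let $\mathcal N$ be a smooth manifold of dimension $2n+1$ with a smooth cooriented contact distribution $\mathcal C\subset T\mathcal N$ (for example, locally, the manifold of unparameterized null geodesics of a Lorentzian manifold of dimension $n+2$), and let $q\in\mathcal N$. Let $S\to\mathcal N$ be the bundle of nonzero covectors $\alpha$ with $\ker\alpha=\mathcal C$ that are positive for the coorientation, so that the local sections of $S$ are the positive local contact forms $\theta$, and let $J^1_qS$ be the set of 1-jets at $q$ of such sections. Let $$\operatorname{gr}(T_q\mathcal N)=\mathcal C_q\oplus(T_q\mathcal N/\mathcal C_q)$$ be the osculating Heisenberg algebra at $q$: its bracket on $\mathcal C_q$ is the Levi bracket $(A(q),B(q))\mapsto[A,B](q)\bmod\mathcal C_q$ for local sections $A,B$ of $\mathcal C$, and $T_q\mathcal N/\mathcal C_q$ is central. A smooth vector field $X$ defined near $q$ has weighted order at least zero at $q$ if $X(q)=0$ and its linear part $A_X:T_q\mathcal N\to T_q\mathcal N$ maps $\mathcal C_q$ into itself; it then induces an endomorphism of $\operatorname{gr}(T_q\mathcal N)$. Let $\mathfrak X^{>1}_q$ be the space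 of those $X$ for which this endomorphism is zero. A weighted first jet of vector fields at $q$ is a class $[X]$ modulo $\mathfrak X^{>1}_q$. Then every 1-jet $j^1_q\theta\in J^1_qS$ canonically determines a weighted first jet $[D_\theta]$ of vector fields at $q$ and a vector $R_\theta\in T_q\mathcal N$ such that, for every local contact form $\theta$ representing the jet: 1. the endomorphism of $\operatorname{gr}(T_q\mathcal N)$ induced by $[D_\theta]$ is the grading derivation of the osculating Heisenberg algebra, acting by $1$ on $\mathcal C_q$ and by $2$ on $T_q\mathcal N/\mathcal C_q$; 2. the degree-two line $T_q\mathcal N/\mathcal C_q$ is represented by the Reeb direction: $R_\theta$ is the value at $q$ of the Reeb field of $\theta$, that is, $\theta(R_\theta)=1$ and $\iota_{R_\theta}d\theta=0$ at $q$; one has $T_q\mathcal N=\mathcal C_q\oplus\mathbb R R_\theta$; and $[D_\theta]$ has a representative whose linear part at $q$ has $\mathbb R R_\theta$ as its eigenspace for the eigenvalue $2$; 3. in every contact Darboux chart $(v,x^1,\dots,x^n,p_1,\dots,p_n)$ for $\theta$ centered at $q$, that is, $\theta=dv+\sum_i p_i\,dx^i$, the class $[D_\theta]$ is represented by $$2v\,\partial_v+\sum_i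 x^i\partial_{x^i}+\sum_i p_i\partial_{p_i}\pmod{\mathfrak X^{>1}_q},$$ and the eigenspace for the eigenvalue $2$ of the linear part of this vector field at $q$ is $\mathbb R R_\theta$. For each $\theta$, the pair $([D_\theta],R_\theta)$ is the only pair with these properties. In particular, if $\theta$ and $\hat\theta$ have the same 1-jet at $q$, then $[D_\theta]=[D_{\hat\theta}]$ and $R_\theta=R_{\hat\theta}$. -/

import Mathlib

open Set Filter Topology Manifold
open scoped ContDiff

noncomputable section

namespace DilationGerm

variable {E : Type*} [NormedAddCommGroup E] [NormedSpace ℝ E]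
variable {N : Type*} [TopologicalSpace N] [ChartedSpace E N]

/-! ### One-forms and vector fields on a manifold

Mathlib's tangent space at `p` is the model space `E`, the identification being the differential
of the preferred chart at `p`.  Hence the first derivative at `p` of the expression of a tensor in
the preferred chart at `p` is again a tensor on `TangentSpace 𝓘(ℝ, E) p`. -/

/-- A (not necessarily smooth) one-form. -/
abbrev OneForm (E : Type*) [NormedAddCommGroup E] [NormedSpace ℝ E]
    (N : Type*) [TopologicalSpace N] [ChartedSpace E N] : Type _ :=
  ∀ q : N, TangentSpace 𝓘(ℝ, E) q →L[ℝ] ℝ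

/-- A (not necessarily smooth) vector field. -/
abbrev VField (E : Type*) [NormedAddCommGroup E] [NormedSpace ℝ E]
    (N : Type*) [TopologicalSpace N] [ChartedSpace E N] : Type _ :=
  ∀ q : N, TangentSpace 𝓘(ℝ, E) q

/-- Smoothness of a one-form on a set, as a section of the cotangent bundle. -/
def SmoothFormOn [IsManifold 𝓘(ℝ, E) ∞ N] (α : OneForm E N) (U : Set N) : Prop :=
  ContMDiffOn 𝓘(ℝ, E) (𝓘(ℝ, E).prod 𝓘(ℝ, E →L[ℝ] ℝ)) ∞
    (fun q => Bundle.TotalSpace.mk' (E →L[ℝ] ℝ)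
      (E := fun q : N => TangentSpace 𝓘(ℝ, E) q →L[ℝ] Bundle.Trivial N ℝ q) q (α q)) U

/-- Smoothness of a vector field on a set, as a section of the tangent bundle. -/
def SmoothFieldOn [IsManifold 𝓘(ℝ, E) ∞ N] (X : VField E N) (U : Set N) : Prop :=
  ContMDiffOn 𝓘(ℝ, E) 𝓘(ℝ, E).tangent ∞
    (fun q => (⟨q, X q⟩ : TangentBundle 𝓘(ℝ, E) N)) U

/-- The expression of a one-form in the preferred chart at `p`
(the pullback by the inverse chart). -/
def formInChart (α : OneForm E N) (p : N) : E → (E →L[ℝ] ℝ) := fun y =>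
  (α ((extChartAt 𝓘(ℝ, E) p).symm y)).comp
    (mfderiv 𝓘(ℝ, E) 𝓘(ℝ, E) (extChartAt 𝓘(ℝ, E) p).symm y)

/-- The first derivative at `p` of a one-form in the preferred chart at `p`. -/
def formDeriv (α : OneForm E N) (p : N) : E →L[ℝ] (E →L[ℝ] ℝ) :=
  fderiv ℝ (formInChart α p) (extChartAt 𝓘(ℝ, E) p p)

/-- The exterior derivative `(dα)_p(a, b) = (∂_a α)(b) - (∂_b α)(a)`. -/
def extD (α : OneForm E N) (p : N) (a b : TangentSpace 𝓘(ℝ, E) p) : ℝ :=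
  formDeriv α p a b - formDeriv α p b a

theorem extD_add_left (α : OneForm E N) (p : N) (a a' b : TangentSpace 𝓘(ℝ, E) p) :
    extD α p (a + a') b = extD α p a b + extD α p a' b := by
  have h1 : formDeriv α p (a + a') = formDeriv α p a + formDeriv α p a' := map_add _ _ _
  have h2 : formDeriv α p b (a + a') = formDeriv α p b a + formDeriv α p b a' := map_add _ _ _
  have h3 : (formDeriv α p a + formDeriv α p a') b = formDeriv α p a b + formDeriv α p a' b := rfl
  unfold extD
  rw [h1, h2, h3]
  ring

theorem extD_smul_left (α : OneForm E N) (p : N) (c : ℝ) (a b : TangentSpace 𝓘(ℝ, E) p) :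
    extD α p (c • a) b = c * extD α p a b := by
  have h1 : formDeriv α p (c • a) = c • formDeriv α p a := map_smul _ _ _
  have h2 : formDeriv α p b (c • a) = c • formDeriv α p b a := map_smul _ _ _
  have h3 : (c • formDeriv α p a) b = c * formDeriv α p a b := rfl
  unfold extD
  rw [h1, h2, h3, smul_eq_mul]
  ring

theorem extD_swap (α : OneForm E N) (p : N) (a b : TangentSpace 𝓘(ℝ, E) p) :
    extD α p b a = -extD α p a b := by
  unfold extD
  ring

/-- The expression of a vector field in the preferred chart at `p`. -/
def fieldInChart (X : VField E N) (p : N) : E → E := fun y =>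
  mfderiv 𝓘(ℝ, E) 𝓘(ℝ, E) (extChartAt 𝓘(ℝ, E) p) ((extChartAt 𝓘(ℝ, E) p).symm y)
    (X ((extChartAt 𝓘(ℝ, E) p).symm y))

/-- The linear part at `p` of a vector field.  It is used only for fields vanishing at `p`, for
which it is independent of the chart. -/
def linearPart (X : VField E N) (p : N) :
    TangentSpace 𝓘(ℝ, E) p →ₗ[ℝ] TangentSpace 𝓘(ℝ, E) p :=
  ((fderiv ℝ (fieldInChart X p) (extChartAt 𝓘(ℝ, E) p p) : E →L[ℝ] E) : E →ₗ[ℝ] E)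

theorem linearPart_add {X Y : VField E N} {p : N}
    (hX : DifferentiableAt ℝ (fieldInChart X p) (extChartAt 𝓘(ℝ, E) p p))
    (hY : DifferentiableAt ℝ (fieldInChart Y p) (extChartAt 𝓘(ℝ, E) p p)) :
    linearPart (X + Y) p = linearPart X p + linearPart Y p := by
  have h : fieldInChart (X + Y) p = fieldInChart X p + fieldInChart Y p := by
    funext y
    exact map_add _ _ _
  unfold linearPart
  rw [h, fderiv_add hX hY]
  rfl

theorem linearPart_smul {X : VField E N} {p : N} (c : ℝ)
    (hX : DifferentiableAt ℝ (fieldInChart X p) (extChartAt 𝓘(ℝ, E) p p)) :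
    linearPart (c • X) p = c • linearPart X p := by
  have h : fieldInChart (c • X) p = c • fieldInChart X p := by
    funext y
    exact map_smul _ _ _
  unfold linearPart
  rw [h, fderiv_const_smul hX]
  rfl

/-! ### Contact structures and contact scales -/

/-- A smooth cooriented contact structure: a field of hyperplanes with a choice of positive side,
which near every point is given by a smooth contact form. -/
structure ContactStructure (E : Type*) [NormedAddCommGroup E] [NormedSpace ℝ E]
    (N : Type*) [TopologicalSpace N] [ChartedSpace E N] [IsManifold 𝓘(ℝ, E) ∞ N] where
  /-- The contact hyperplane at a point. -/
  plane : ∀ q : N, Submodule ℝ (TangentSpace 𝓘(ℝ, E) q)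
  /-- The positive side of the contact hyperplane. -/
  positive : ∀ q : N, Set (TangentSpace 𝓘(ℝ, E) q)
  exists_form : ∀ p : N, ∃ (U : Set N) (α : OneForm E N), IsOpen U ∧ p ∈ U ∧ SmoothFormOn α U ∧
    ∀ q ∈ U, α q ≠ 0 ∧ LinearMap.ker (α q : TangentSpace 𝓘(ℝ, E) q →ₗ[ℝ] ℝ) = plane q ∧
      {X | 0 < α q X} = positive q ∧
      ∀ a ∈ plane q, (∀ b ∈ plane q, extD α q a b = 0) → a = 0

variable [IsManifold 𝓘(ℝ, E) ∞ N]

/-- The fibre at `q` of the symplectization: the nonzero covectors with kernel the contact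
hyperplane that are positive for the coorientation. -/
def ContactStructure.scaleFibre (K : ContactStructure E N) (q : N) :
    Set (TangentSpace 𝓘(ℝ, E) q →L[ℝ] ℝ) :=
  {α | α ≠ 0 ∧ LinearMap.ker (α : TangentSpace 𝓘(ℝ, E) q →ₗ[ℝ] ℝ) = K.plane q ∧
    ∀ X ∈ K.positive q, 0 < α X}

/-- A local contact form near `p`, that is, a smooth local section near `p` of the
symplectization. -/
structure LocalScale (K : ContactStructure E N) (p : N) where
  domain : Set N
  isOpen_domain : IsOpen domain
  mem_domain : p ∈ domain
  form : OneForm E N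
  smooth : SmoothFormOn form domain
  mem_fibre : ∀ q ∈ domain, form q ∈ K.scaleFibre q

theorem nonempty_localScale (K : ContactStructure E N) (p : N) : Nonempty (LocalScale K p) := by
  obtain ⟨U, α, hU, hp, hs, h⟩ := K.exists_form p
  refine ⟨⟨U, hU, hp, α, hs, fun q hq => ⟨(h q hq).1, (h q hq).2.1, fun X hX => ?_⟩⟩⟩
  have := (h q hq).2.2.1
  rw [← this] at hX
  exact hX

/-- Two local contact forms have the same 1-jet at `p`: their values and first derivatives at `p`
agree in a chart. -/
def sameJet (K : ContactStructure E N) (p : N) : Setoid (LocalScale K p) where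
  r θ η := θ.form p = η.form p ∧ formDeriv θ.form p = formDeriv η.form p
  iseqv := ⟨fun _ => ⟨rfl, rfl⟩, fun h => ⟨h.1.symm, h.2.symm⟩,
    fun h h' => ⟨h.1.trans h'.1, h.2.trans h'.2⟩⟩

/-- The 1-jets at `p` of local sections of the symplectization. -/
def ScaleJet (K : ContactStructure E N) (p : N) : Type _ := Quotient (sameJet K p)

/-- The 1-jet at `p` of a local contact form. -/
def LocalScale.jet {K : ContactStructure E N} {p : N} (θ : LocalScale K p) : ScaleJet K p :=
  Quotient.mk (sameJet K p) θ

/-- `R` is the value at `p` of the Reeb field of the contact form `α`. -/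
def IsReebAt (α : OneForm E N) (p : N) (R : TangentSpace 𝓘(ℝ, E) p) : Prop :=
  α p R = 1 ∧ ∀ Y, extD α p R Y = 0

/-! ### The osculating Heisenberg algebra -/

/-- The osculating graded tangent space: the contact hyperplane in degree one, and the quotient
of the tangent space by it in degree two. -/
def Osc (K : ContactStructure E N) (p : N) : Type _ :=
  K.plane p × (TangentSpace 𝓘(ℝ, E) p ⧸ K.plane p)

instance (K : ContactStructure E N) (p : N) : AddCommGroup (Osc K p) :=
  inferInstanceAs (AddCommGroup (K.plane p × (TangentSpace 𝓘(ℝ, E) p ⧸ K.plane p)))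

instance (K : ContactStructure E N) (p : N) : Module ℝ (Osc K p) :=
  inferInstanceAs (Module ℝ (K.plane p × (TangentSpace 𝓘(ℝ, E) p ⧸ K.plane p)))


theorem LocalScale.exists_eq_one {K : ContactStructure E N} {p : N} (θ : LocalScale K p) :
    ∃ Z, θ.form p Z = 1 := by
  obtain ⟨Z, hZ⟩ := DFunLike.ne_iff.1 (θ.mem_fibre p θ.mem_domain).1
  refine ⟨(θ.form p Z)⁻¹ • Z, ?_⟩
  rw [map_smul, smul_eq_mul]
  exact inv_mul_cancel₀ (by simpa using hZ)

/-- The Levi bracket computed with the contact form `θ`: the class `z` in the quotient line with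
`θ(z) = -dθ(a, b)`.  By `dθ(A, B) = A θ(B) - B θ(A) - θ([A, B])`, it is the class of `[A, B](p)`
for sections `A`, `B` of the contact distribution that extend `a`, `b`. -/
def LocalScale.levi {K : ContactStructure E N} {p : N} (θ : LocalScale K p)
    (a b : K.plane p) : TangentSpace 𝓘(ℝ, E) p ⧸ K.plane p :=
  (-extD θ.form p a b) • (K.plane p).mkQ θ.exists_eq_one.choose


theorem differentiableAt_formInChart {α : OneForm E N} {U : Set N} (hU : IsOpen U)
    (hα : SmoothFormOn α U) {p : N} (hp : p ∈ U) :
    DifferentiableAt ℝ (formInChart α p) (extChartAt 𝓘(ℝ, E) p p) := by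
  have h := (hα p hp).contMDiffAt (hU.mem_nhds hp)
  rw [contMDiffAt_hom_bundle] at h
  have h2 := h.2
  have h3 : ContMDiffAt 𝓘(ℝ, E) 𝓘(ℝ, E) ∞ (extChartAt 𝓘(ℝ, E) p).symm
      (extChartAt 𝓘(ℝ, E) p p) :=
    (contMDiffOn_extChartAt_symm p).contMDiffAt (extChartAt_target_mem_nhds p)
  have h4 : (extChartAt 𝓘(ℝ, E) p).symm (extChartAt 𝓘(ℝ, E) p p) = p := extChartAt_to_inv p
  have h5 := ContMDiffAt.comp (extChartAt 𝓘(ℝ, E) p p) (by rw [h4]; exact h2) h3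
  have h6 := (contMDiffAt_iff_contDiffAt.1 h5).differentiableAt (by simp)
  refine h6.congr_of_eventuallyEq ?_
  filter_upwards [extChartAt_target_mem_nhds (I := 𝓘(ℝ, E)) p] with y hy
  have hy' := (extChartAt 𝓘(ℝ, E) p).map_target hy
  have hy2 : (extChartAt 𝓘(ℝ, E) p).symm y ∈ (chartAt E p).source := by
    simpa using hy'
  have key := TangentBundle.symmL_trivializationAt (I := 𝓘(ℝ, E)) (x₀ := p) hy2
  rw [(extChartAt 𝓘(ℝ, E) p).right_inv hy] at key
  simp only [modelWithCornersSelf_coe, range_id, mfderivWithin_univ] at key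
  ext w
  simp only [formInChart, Function.comp, ContinuousLinearMap.inCoordinates, key]
  simp

/-- The chart expression of a smooth vector field is differentiable. -/
theorem differentiableAt_fieldInChart {X : VField E N} {U : Set N} (hU : IsOpen U)
    (hX : SmoothFieldOn X U) {p : N} (hp : p ∈ U) :
    DifferentiableAt ℝ (fieldInChart X p) (extChartAt 𝓘(ℝ, E) p p) := by
  have h2 := (hX p hp).contMDiffAt (hU.mem_nhds hp)
  have h2 := (Bundle.contMDiffAt_section p).1 h2
  have h3 : ContMDiffAt 𝓘(ℝ, E) 𝓘(ℝ, E) ∞ (extChartAt 𝓘(ℝ, E) p).symm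
      (extChartAt 𝓘(ℝ, E) p p) :=
    (contMDiffOn_extChartAt_symm p).contMDiffAt (extChartAt_target_mem_nhds p)
  have h4 : (extChartAt 𝓘(ℝ, E) p).symm (extChartAt 𝓘(ℝ, E) p p) = p := extChartAt_to_inv p
  have h5 := ContMDiffAt.comp (extChartAt 𝓘(ℝ, E) p p) (by rw [h4]; exact h2) h3
  have h6 := (contMDiffAt_iff_contDiffAt.1 h5).differentiableAt (by simp)
  refine h6.congr_of_eventuallyEq ?_
  filter_upwards [extChartAt_target_mem_nhds (I := 𝓘(ℝ, E)) p] with y hy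
  have hy' := (extChartAt 𝓘(ℝ, E) p).map_target hy
  have hy2 : (extChartAt 𝓘(ℝ, E) p).symm y ∈ (chartAt E p).source := by
    simpa using hy'
  have key := TangentBundle.continuousLinearMapAt_trivializationAt (I := 𝓘(ℝ, E)) (x₀ := p) hy2
  have key2 := congrArg (fun L => L (X ((extChartAt 𝓘(ℝ, E) p).symm y))) key
  refine Eq.trans key2.symm ?_
  rw [Bundle.Trivialization.continuousLinearMapAt_apply,
    Bundle.Trivialization.linearMapAt_apply, if_pos (by simpa using hy2)]
  rfl

theorem formInChart_self (α : OneForm E N) (p : N) (w : E) :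
    formInChart α p (extChartAt 𝓘(ℝ, E) p p) w = α p w := by
  have key := TangentBundle.symmL_trivializationAt (I := 𝓘(ℝ, E)) (x₀ := p)
    (mem_chart_source E p)
  simp only [modelWithCornersSelf_coe, range_id, mfderivWithin_univ] at key
  have h1 : (mfderiv 𝓘(ℝ, E) 𝓘(ℝ, E) (extChartAt 𝓘(ℝ, E) p).symm
      (extChartAt 𝓘(ℝ, E) p p) : E → E) w = w := by
    have h2 := congrArg (fun L : E →L[ℝ] E => L w) key
    refine h2.symm.trans ?_
    have h3 := TangentBundle.symmL_trivializationAt_eq_core (I := 𝓘(ℝ, E)) (b₀ := p)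
      (mem_chart_source E p)
    refine (congrArg (fun L : E →L[ℝ] E => L w) h3).trans ?_
    exact (tangentBundleCore 𝓘(ℝ, E) N).coordChange_self (achart E p) p
      (mem_chart_source E p) w
  have h4 : ∀ q : N, q = p → (α q : E → ℝ) w = (α p : E → ℝ) w := by
    rintro q rfl
    rfl
  have h5 : formInChart α p (extChartAt 𝓘(ℝ, E) p p) w =
      (α ((extChartAt 𝓘(ℝ, E) p).symm (extChartAt 𝓘(ℝ, E) p p)) : E → ℝ)
        ((mfderiv 𝓘(ℝ, E) 𝓘(ℝ, E) (extChartAt 𝓘(ℝ, E) p).symm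
      (extChartAt 𝓘(ℝ, E) p p) : E → E) w) := rfl
  rw [h5, h1]
  exact h4 _ (extChartAt_to_inv p)

/-- The Levi bracket does not depend on the contact form. -/
theorem levi_indep {K : ContactStructure E N} {p : N} (θ η : LocalScale K p) (a b : K.plane p) :
    θ.levi a b = η.levi a b := by
  have hker : ∀ (ζ : LocalScale K p) (q : N), q ∈ ζ.domain →
      ∀ X, ζ.form q X = 0 ↔ X ∈ K.plane q := by
    intro ζ q hq X
    rw [← (ζ.mem_fibre q hq).2.1]
    rfl
  have hev : ∀ ζ : LocalScale K p, ∀ᶠ y in 𝓝 (extChartAt 𝓘(ℝ, E) p p),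
      (extChartAt 𝓘(ℝ, E) p).symm y ∈ ζ.domain := by
    intro ζ
    have hc := continuousAt_extChartAt_symm (I := 𝓘(ℝ, E)) p
    refine hc.preimage_mem_nhds (ζ.isOpen_domain.mem_nhds ?_)
    rw [extChartAt_to_inv]
    exact ζ.mem_domain
  set y₀ := extChartAt 𝓘(ℝ, E) p p with hy₀
  have hF := differentiableAt_formInChart θ.isOpen_domain θ.smooth θ.mem_domain
  have hG := differentiableAt_formInChart η.isOpen_domain η.smooth η.mem_domain
  set F := formInChart θ.form p with hFdef
  set G := formInChart η.form p with hGdef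
  have hprop : ∀ Z w : E, ∀ᶠ y in 𝓝 y₀, G y w * F y Z = G y Z * F y w := by
    intro Z w
    filter_upwards [hev θ, hev η] with y h1 h2
    have h3 : F y (F y Z • w - F y w • Z) = 0 := by
      rw [map_sub, map_smul, map_smul, smul_eq_mul, smul_eq_mul]
      ring
    have h4 : G y (F y Z • w - F y w • Z) = 0 :=
      (hker η _ h2 _).2 ((hker θ _ h1 _).1 h3)
    rw [map_sub, map_smul, map_smul, smul_eq_mul, smul_eq_mul] at h4
    linarith
  have hder : ∀ Z w v : E, fderiv ℝ G y₀ v w * F y₀ Z + G y₀ w * fderiv ℝ F y₀ v Z =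
      fderiv ℝ G y₀ v Z * F y₀ w + G y₀ Z * fderiv ℝ F y₀ v w := by
    intro Z w v
    have hc : ∀ (A : E → E →L[ℝ] ℝ) (u : E), DifferentiableAt ℝ A y₀ →
        HasFDerivAt (fun y => A y u) ((fderiv ℝ A y₀).flip u) y₀ := by
      intro A u hA
      have := (ContinuousLinearMap.apply ℝ ℝ u).hasFDerivAt.comp y₀ hA.hasFDerivAt
      exact this
    have e1 := (hc G w hG).mul (hc F Z hF)
    have e2 := (hc G Z hG).mul (hc F w hF)
    have e3 := (e1.congr_of_eventuallyEq ((hprop Z w).mono fun y hy => hy.symm)).unique e2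
    have e4 := congrArg (fun L : E →L[ℝ] ℝ => L v) e3
    simp at e4
    linarith
  have hself : ∀ (ζ : LocalScale K p) (w : E), formInChart ζ.form p y₀ w = ζ.form p w :=
    fun ζ w => formInChart_self ζ.form p w
  obtain ⟨Z, hZ⟩ : ∃ Z, Z = θ.exists_eq_one.choose := ⟨_, rfl⟩
  obtain ⟨W, hW⟩ : ∃ W, W = η.exists_eq_one.choose := ⟨_, rfl⟩
  have hZ1 : θ.form p Z = 1 := hZ ▸ θ.exists_eq_one.choose_spec
  have hW1 : η.form p W = 1 := hW ▸ η.exists_eq_one.choose_spec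
  have hFZ : F y₀ Z = 1 := (hself θ Z).trans hZ1
  have hd : ∀ v w : TangentSpace 𝓘(ℝ, E) p, w ∈ K.plane p →
      formDeriv η.form p v w = η.form p Z * formDeriv θ.form p v w := by
    intro v w hw
    have h1 : F y₀ w = 0 := (hself θ w).trans ((hker θ p θ.mem_domain w).2 hw)
    have h2 : G y₀ w = 0 := (hself η w).trans ((hker η p η.mem_domain w).2 hw)
    have h3 : G y₀ Z = η.form p Z := hself η Z
    have h4 := hder Z w v
    rw [hFZ, h1, h2, h3] at h4
    have h5 : fderiv ℝ G y₀ v w = η.form p Z * fderiv ℝ F y₀ v w := by linarith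
    exact h5
  have hE : extD η.form p a b = η.form p Z * extD θ.form p a b := by
    unfold extD
    rw [hd _ _ b.2, hd _ _ a.2]
    ring
  have hq : (K.plane p).mkQ Z = η.form p Z • (K.plane p).mkQ W := by
    rw [← map_smul, ← sub_eq_zero, ← map_sub]
    refine (Submodule.Quotient.mk_eq_zero _).2 ((hker η p η.mem_domain _).1 ?_)
    rw [map_sub, map_smul, hW1, smul_eq_mul, mul_one, sub_self]
  unfold LocalScale.levi
  rw [← hZ, ← hW, hq, hE, smul_smul]
  congr 1
  ring

instance (K : ContactStructure E N) (p : N) : Bracket (Osc K p) (Osc K p) :=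
  ⟨fun x y => ((0, (nonempty_localScale K p).some.levi x.1 y.1) :
    K.plane p × (TangentSpace 𝓘(ℝ, E) p ⧸ K.plane p))⟩

theorem Osc.bracket_eq {K : ContactStructure E N} {p : N} (θ : LocalScale K p) (x y : Osc K p) :
    ⁅x, y⁆ = ((0, θ.levi x.1 y.1) : K.plane p × (TangentSpace 𝓘(ℝ, E) p ⧸ K.plane p)) :=
  Prod.ext rfl (levi_indep _ _ _ _)

section levi
variable {K : ContactStructure E N} {p : N} (θ : LocalScale K p)

theorem levi_add_left (a a' b : K.plane p) : θ.levi (a + a') b = θ.levi a b + θ.levi a' b := by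
  unfold LocalScale.levi
  rw [← add_smul, Submodule.coe_add, extD_add_left]
  congr 1
  ring

theorem levi_swap (a b : K.plane p) : θ.levi b a = -θ.levi a b := by
  unfold LocalScale.levi
  rw [← neg_smul, extD_swap]

theorem levi_smul_left (c : ℝ) (a b : K.plane p) : θ.levi (c • a) b = c • θ.levi a b := by
  unfold LocalScale.levi
  rw [smul_smul, Submodule.coe_smul, extD_smul_left]
  congr 1
  ring

theorem levi_self (a : K.plane p) : θ.levi a a = 0 := by
  unfold LocalScale.levi extD
  simp

theorem levi_zero_left (b : K.plane p) : θ.levi 0 b = 0 := by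
  simpa using levi_smul_left θ 0 0 b

theorem levi_add_right (a b b' : K.plane p) : θ.levi a (b + b') = θ.levi a b + θ.levi a b' := by
  rw [levi_swap, levi_add_left, levi_swap θ a b, levi_swap θ a b']
  abel

theorem levi_smul_right (c : ℝ) (a b : K.plane p) : θ.levi a (c • b) = c • θ.levi a b := by
  rw [levi_swap, levi_smul_left, levi_swap θ a b]
  simp

theorem levi_zero_right (b : K.plane p) : θ.levi b 0 = 0 := by
  simpa using levi_smul_right θ 0 b 0

end levi

/-- The osculating Heisenberg algebra: the bracket of two elements of degree one is their Levi
bracket, and the degree-two line is central. -/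
instance (K : ContactStructure E N) (p : N) : LieRing (Osc K p) where
  add_lie x y z := Prod.ext (add_zero (0 : K.plane p)).symm (levi_add_left _ _ _ _)
  lie_add x y z := Prod.ext (add_zero (0 : K.plane p)).symm (levi_add_right _ _ _ _)
  lie_self x := Prod.ext rfl (levi_self _ _)
  leibniz_lie x y z := Prod.ext (add_zero (0 : K.plane p)).symm <|
    (levi_zero_right _ _).trans <| by
      refine (add_zero (0 : TangentSpace 𝓘(ℝ, E) p ⧸ K.plane p)).symm.trans ?_
      exact (congrArg₂ (· + ·) (levi_zero_left _ _) (levi_zero_right _ _)).symm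

instance (K : ContactStructure E N) (p : N) : LieAlgebra ℝ (Osc K p) where
  lie_smul c _ _ := Prod.ext (smul_zero c).symm (levi_smul_right _ _ _ _)

/-- The grading derivation of the osculating Heisenberg algebra: it acts by `1` on the contact
hyperplane and by `2` on the quotient line. -/
def gradingDerivation (K : ContactStructure E N) (p : N) :
    LieDerivation ℝ (Osc K p) (Osc K p) where
  toFun x := ((x.1, (2 : ℝ) • x.2) : K.plane p × (TangentSpace 𝓘(ℝ, E) p ⧸ K.plane p))
  map_add' x y := Prod.ext rfl (smul_add (2 : ℝ) x.2 y.2)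
  map_smul' c x := Prod.ext rfl (smul_comm (2 : ℝ) c x.2)
  leibniz' _ _ := Prod.ext (sub_zero (0 : K.plane p)).symm <| by
    refine (two_smul ℝ _).trans ((sub_neg_eq_add _ _).symm.trans ?_)
    exact congrArg₂ (· - ·) rfl (levi_swap _ _ _).symm

/-! ### Weighted first jets of vector fields -/

/-- The vector fields, smooth near `p`, of weighted order at least zero at `p`: they vanish at `p`
and their linear part preserves the contact hyperplane, so that they act on the osculating
graded tangent space. -/
def filteredFields (K : ContactStructure E N) (p : N) : Submodule ℝ (VField E N) where
  carrier := {X | (∃ U, IsOpen U ∧ p ∈ U ∧ SmoothFieldOn X U) ∧ X p = 0 ∧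
    ∀ a ∈ K.plane p, linearPart X p a ∈ K.plane p}
  add_mem' := by
    rintro X Y ⟨⟨U, hU, hpU, hX⟩, hX0, hXC⟩ ⟨⟨V, hV, hpV, hY⟩, hY0, hYC⟩
    refine ⟨⟨U ∩ V, hU.inter hV, ⟨hpU, hpV⟩,
      (hX.mono inter_subset_left).add_section (hY.mono inter_subset_right)⟩, ?_, ?_⟩
    · rw [Pi.add_apply, hX0, hY0, add_zero]
    · intro a ha
      rw [linearPart_add (differentiableAt_fieldInChart hU hX hpU)
        (differentiableAt_fieldInChart hV hY hpV)]
      exact add_mem (hXC a ha) (hYC a ha)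
  zero_mem' := by
    refine ⟨⟨univ, isOpen_univ, mem_univ _, ?_⟩, rfl, ?_⟩
    · exact (Bundle.contMDiff_zeroSection ℝ (TangentSpace 𝓘(ℝ, E) (M := N))).contMDiffOn
    · intro a ha
      have h : fieldInChart (0 : VField E N) p = fun _ => 0 := by
        funext y
        exact map_zero _
      have h2 : linearPart (0 : VField E N) p = 0 := by
        unfold linearPart
        rw [h, fderiv_fun_const]
        rfl
      rw [h2]
      exact zero_mem _
  smul_mem' := by
    rintro c X ⟨⟨U, hU, hpU, hX⟩, hX0, hXC⟩
    refine ⟨⟨U, hU, hpU, hX.const_smul_section⟩, ?_, ?_⟩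
    · rw [Pi.smul_apply, hX0, smul_zero]
    · intro a ha
      rw [linearPart_smul c (differentiableAt_fieldInChart hU hX hpU)]
      exact (K.plane p).smul_mem c (hXC a ha)

/-- The endomorphism of the osculating graded tangent space induced by a vector field of
weighted order at least zero. -/
def grField (K : ContactStructure E N) (p : N) :
    filteredFields K p →ₗ[ℝ] (Osc K p →ₗ[ℝ] Osc K p) where
  toFun X := LinearMap.prodMap ((linearPart X.1 p).restrict X.2.2.2)
    ((K.plane p).mapQ (K.plane p) (linearPart X.1 p) X.2.2.2)
  map_add' := by
    rintro ⟨X, ⟨U, hU, hpU, hX⟩, hX0, hXC⟩ ⟨Y, ⟨V, hV, hpV, hY⟩, hY0, hYC⟩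
    have h := linearPart_add (differentiableAt_fieldInChart hU hX hpU)
        (differentiableAt_fieldInChart hV hY hpV)
    refine LinearMap.ext fun x => Prod.ext (Subtype.ext (LinearMap.congr_fun h _)) ?_
    obtain ⟨x, z⟩ := x
    induction z using Submodule.Quotient.induction_on with
    | H z => exact congrArg (K.plane p).mkQ (LinearMap.congr_fun h z)
  map_smul' := by
    rintro c ⟨X, ⟨U, hU, hpU, hX⟩, hX0, hXC⟩
    have h := linearPart_smul c (differentiableAt_fieldInChart hU hX hpU)
    refine LinearMap.ext fun x => Prod.ext (Subtype.ext (LinearMap.congr_fun h _)) ?_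
    obtain ⟨x, z⟩ := x
    induction z using Submodule.Quotient.induction_on with
    | H z => exact congrArg (K.plane p).mkQ (LinearMap.congr_fun h z)

/-- The vector fields of weighted order at least zero whose induced endomorphism of the osculating
graded tangent space is zero. -/
def higherFields (K : ContactStructure E N) (p : N) : Submodule ℝ (filteredFields K p) :=
  LinearMap.ker (grField K p)

/-- Weighted first jets of vector fields at `p`. -/
abbrev WeightedJet (K : ContactStructure E N) (p : N) : Type _ :=
  filteredFields K p ⧸ higherFields K p

/-- The endomorphism of the osculating graded tangent space induced by a weighted first jet. -/
def WeightedJet.gr {K : ContactStructure E N} {p : N} (w : WeightedJet K p) :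
    Osc K p →ₗ[ℝ] Osc K p :=
  (higherFields K p).liftQ (grField K p) le_rfl w

/-- The vector field `X` represents the weighted first jet `w`. -/
def Represents {K : ContactStructure E N} {p : N} (X : VField E N) (w : WeightedJet K p) : Prop :=
  ∃ h : X ∈ filteredFields K p, (higherFields K p).mkQ ⟨X, h⟩ = w

/-! ### Darboux charts -/

/-- The coordinate space with points `(v, x, p)`. -/
abbrev Coord (n : ℕ) : Type := ℝ × (Fin n → ℝ) × (Fin n → ℝ)

/-- `φ` is a contact Darboux chart `(v, x, p)` for `θ` centred at `p`: a smooth chart with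
`φ(p) = 0` in which `θ = dv + ∑ i, p_i dx^i`. -/
structure IsDarbouxChart {K : ContactStructure E N} {p : N} (θ : LocalScale K p) {n : ℕ}
    (φ : OpenPartialHomeomorph N (Coord n)) : Prop where
  mem_source : p ∈ φ.source
  map_base : φ p = 0
  source_subset : φ.source ⊆ θ.domain
  smooth : ContMDiffOn 𝓘(ℝ, E) 𝓘(ℝ, Coord n) ∞ φ φ.source
  smooth_symm : ContMDiffOn 𝓘(ℝ, Coord n) 𝓘(ℝ, E) ∞ φ.symm φ.target
  form_eq : ∀ q ∈ φ.source, ∀ X : TangentSpace 𝓘(ℝ, E) q,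
    θ.form q X =
      (mfderiv 𝓘(ℝ, E) 𝓘(ℝ, Coord n) φ q X : Coord n).1 +
        ∑ i, (φ q).2.2 i * (mfderiv 𝓘(ℝ, E) 𝓘(ℝ, Coord n) φ q X : Coord n).2.1 i

/-- The vector field `2 v ∂_v + x^i ∂_{x^i} + p_i ∂_{p_i}` on the coordinate space. -/
def eulerField (n : ℕ) : ∀ y : Coord n, TangentSpace 𝓘(ℝ, Coord n) y :=
  fun y => ((2 * y.1, y.2.1, y.2.2) : Coord n)

/-- The vector field `2 v ∂_v + x^i ∂_{x^i} + p_i ∂_{p_i}` of the chart `φ`; only its values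
on the source of `φ` matter. -/
def chartEuler {n : ℕ} (φ : OpenPartialHomeomorph N (Coord n)) : VField E N :=
  VectorField.mpullback 𝓘(ℝ, E) 𝓘(ℝ, Coord n) φ (eulerField n)

/-- The weighted first jet `w` together with the tangent vector `R` at `p` is the realized
dilation germ of the contact form `θ`. -/
structure IsDilationJet {K : ContactStructure E N} {p : N} (n : ℕ) (θ : LocalScale K p)
    (w : WeightedJet K p) (R : TangentSpace 𝓘(ℝ, E) p) : Prop where
  /-- The induced endomorphism of the osculating Heisenberg algebra is the grading derivation. -/
  grading : w.gr = (gradingDerivation K p : Osc K p →ₗ[ℝ] Osc K p)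
  /-- `R` is the Reeb vector of `θ` at `p`. -/
  reeb : IsReebAt θ.form p R
  /-- The Reeb line maps isomorphically onto the degree-two line. -/
  isCompl : IsCompl (K.plane p) (Submodule.span ℝ {R})
  /-- Some representative of `w` has the Reeb line as weight-two eigenspace of its linear part. -/
  realized : ∃ X : VField E N, Represents X w ∧
    Module.End.eigenspace (linearPart X p) 2 = Submodule.span ℝ {R}
  /-- In every contact Darboux chart for `θ` the field `2 v ∂_v + x^i ∂_{x^i} + p_i ∂_{p_i}`
  represents `w`, and the weight-two eigenspace of its linear part is the Reeb line. -/
  darboux : ∀ φ : OpenPartialHomeomorph N (Coord n), IsDarbouxChart θ φ →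
    Represents (chartEuler φ) w ∧
      Module.End.eigenspace (linearPart (chartEuler φ : VField E N) p) 2 = Submodule.span ℝ {R}

end DilationGerm

end

/-!
# The dilation germ determined by the 1-jet of a contact form

A weighted first jet is determined by the endomorphism of the osculating algebra that it induces
(`WeightedJet.gr_injective`), so the grading condition alone fixes the class `[D_θ]`.  The Reeb
vector `R_θ` exists and is unique because `dθ` is nondegenerate on the contact hyperplane
(`LocalScale.eq_zero_of_extD_eq_zero`), and its defining equations involve only the value and the
first derivative of `θ` at the point.  Hence the pair depends only on the 1-jet
(`IsDilationJet.congr`).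

For existence, the endomorphism `a ↦ a + θ(a) R_θ` is the identity on the contact hyperplane, is
multiplication by `2` modulo it, and has the Reeb line as its eigenspace for `2`; it is the linear
part of the field given by the corresponding linear field in a chart (`exists_dilationField`).

For a Darboux chart, let `B` be the derivative at the point of the transition map from the
preferred chart.  The linear part `A` of the pulled back Euler field satisfies `B A = L B` with
`L = diag(2, 1, 1)` (`fderiv_transition_linearPart`), and the first component of `B` is `θ`, so `A`
induces the grading derivation.  Differentiating `θ = dv + ∑ p_i dx^i` and using the symmetry of
the second derivative gives `dθ = ∑ dp_i ∧ dx^i` at the point, whence `B R_θ = ∂_v`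
(`IsDarbouxChart.fderiv_transition_reeb`) and the eigenspace of `A` for `2` is the Reeb line.
-/

namespace DilationGerm

/-! ### Pullback of vector fields by a chart -/

section ChartTransition

variable {E : Type*} [NormedAddCommGroup E] [NormedSpace ℝ E]
  {N : Type*} [TopologicalSpace N] [ChartedSpace E N]
  {F : Type*} [NormedAddCommGroup F] [NormedSpace ℝ F]

/-- The transition map from the preferred chart at `p` to the chart `φ`. -/
noncomputable def transition (φ : OpenPartialHomeomorph N F) (p : N) : E → F :=
  φ ∘ (extChartAt 𝓘(ℝ, E) p).symm

omit [NormedSpace ℝ F] in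
theorem transition_self (φ : OpenPartialHomeomorph N F) (p : N) :
    transition φ p (extChartAt 𝓘(ℝ, E) p p) = φ p :=
  congrArg φ (extChartAt_to_inv p)

omit [NormedSpace ℝ F] in
theorem eventually_symm_mem_source {φ : OpenPartialHomeomorph N F} {p : N} (hp : p ∈ φ.source) :
    ∀ᶠ y in 𝓝 (extChartAt 𝓘(ℝ, E) p p),
      y ∈ (extChartAt 𝓘(ℝ, E) p).target ∧ (extChartAt 𝓘(ℝ, E) p).symm y ∈ φ.source := by
  refine (eventually_mem_set.2 (extChartAt_target_mem_nhds p)).and ?_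
  refine (continuousAt_extChartAt_symm (I := 𝓘(ℝ, E)) p).preimage_mem_nhds
    (φ.open_source.mem_nhds ?_)
  rwa [extChartAt_to_inv]

variable [IsManifold 𝓘(ℝ, E) ∞ N]

theorem contDiffAt_transition {φ : OpenPartialHomeomorph N F}
    (hφ : ContMDiffOn 𝓘(ℝ, E) 𝓘(ℝ, F) ∞ φ φ.source) {p : N} (hp : p ∈ φ.source) :
    ContDiffAt ℝ ∞ (transition φ p) (extChartAt 𝓘(ℝ, E) p p) := by
  have h3 : ContMDiffAt 𝓘(ℝ, E) 𝓘(ℝ, E) ∞ (extChartAt 𝓘(ℝ, E) p).symm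
      (extChartAt 𝓘(ℝ, E) p p) :=
    (contMDiffOn_extChartAt_symm p).contMDiffAt (extChartAt_target_mem_nhds p)
  refine contMDiffAt_iff_contDiffAt.1 (ContMDiffAt.comp _ ?_ h3)
  rw [extChartAt_to_inv]
  exact hφ.contMDiffAt (φ.open_source.mem_nhds hp)

theorem eventually_fderiv_transition {φ : OpenPartialHomeomorph N F}
    (hφ : ContMDiffOn 𝓘(ℝ, E) 𝓘(ℝ, F) ∞ φ φ.source) {p : N} (hp : p ∈ φ.source) :
    ∀ᶠ y in 𝓝 (extChartAt 𝓘(ℝ, E) p p), ∀ w : E,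
      fderiv ℝ (transition φ p) y w =
        mfderiv 𝓘(ℝ, E) 𝓘(ℝ, F) φ ((extChartAt 𝓘(ℝ, E) p).symm y)
          (mfderiv 𝓘(ℝ, E) 𝓘(ℝ, E) (extChartAt 𝓘(ℝ, E) p).symm y w) := by
  filter_upwards [eventually_symm_mem_source hp] with y hy w
  have h1 : MDifferentiableAt 𝓘(ℝ, E) 𝓘(ℝ, E) (extChartAt 𝓘(ℝ, E) p).symm y :=
    ((contMDiffOn_extChartAt_symm (n := ∞) p).contMDiffAt
      ((isOpen_extChartAt_target p).mem_nhds hy.1)).mdifferentiableAt (by simp)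
  have h2 : MDifferentiableAt 𝓘(ℝ, E) 𝓘(ℝ, F) φ ((extChartAt 𝓘(ℝ, E) p).symm y) :=
    (hφ.contMDiffAt (φ.open_source.mem_nhds hy.2)).mdifferentiableAt (by simp)
  rw [← mfderiv_eq_fderiv, transition, mfderiv_comp y h2 h1]
  rfl

omit [IsManifold 𝓘(ℝ, E) ∞ N] in
theorem mfderiv_isInvertible {φ : OpenPartialHomeomorph N F}
    (hφ : ContMDiffOn 𝓘(ℝ, E) 𝓘(ℝ, F) ∞ φ φ.source)
    (hφ' : ContMDiffOn 𝓘(ℝ, F) 𝓘(ℝ, E) ∞ φ.symm φ.target) {q : N} (hq : q ∈ φ.source) :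
    (mfderiv 𝓘(ℝ, E) 𝓘(ℝ, F) φ q).IsInvertible := by
  have h : φ.MDifferentiable 𝓘(ℝ, E) 𝓘(ℝ, F) :=
    ⟨hφ.mdifferentiableOn (by simp), hφ'.mdifferentiableOn (by simp)⟩
  have h1 := h.comp_symm_deriv (φ.map_source hq)
  rw [φ.left_inv hq] at h1
  exact ContinuousLinearMap.IsInvertible.of_inverse h1 (h.symm_comp_deriv hq)

theorem bijective_fderiv_transition {φ : OpenPartialHomeomorph N F}
    (hφ : ContMDiffOn 𝓘(ℝ, E) 𝓘(ℝ, F) ∞ φ φ.source)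
    (hφ' : ContMDiffOn 𝓘(ℝ, F) 𝓘(ℝ, E) ∞ φ.symm φ.target) {p : N} (hp : p ∈ φ.source) :
    Function.Bijective (fderiv ℝ (transition φ p) (extChartAt 𝓘(ℝ, E) p p)) := by
  have h1 : (fderiv ℝ (transition φ p) (extChartAt 𝓘(ℝ, E) p p) : E → F) =
      (mfderiv 𝓘(ℝ, E) 𝓘(ℝ, F) φ ((extChartAt 𝓘(ℝ, E) p).symm (extChartAt 𝓘(ℝ, E) p p))) ∘
      (mfderiv 𝓘(ℝ, E) 𝓘(ℝ, E) (extChartAt 𝓘(ℝ, E) p).symm (extChartAt 𝓘(ℝ, E) p p)) :=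
    funext (eventually_fderiv_transition hφ hp).self_of_nhds
  rw [h1]
  have h2 := mfderiv_isInvertible hφ hφ' (q := (extChartAt 𝓘(ℝ, E) p).symm
    (extChartAt 𝓘(ℝ, E) p p)) (by rwa [extChartAt_to_inv])
  have h3 := isInvertible_mfderivWithin_extChartAt_symm (I := 𝓘(ℝ, E)) (mem_extChartAt_target p)
  simp only [modelWithCornersSelf_coe, range_id, mfderivWithin_univ] at h3
  exact h2.bijective.comp h3.bijective

/-- In the preferred chart at `p`, the pullback of a vector field by the chart `φ` is related to
that field by the transition map. -/
theorem eventually_fieldInChart_mpullback {φ : OpenPartialHomeomorph N F}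
    (hφ : ContMDiffOn 𝓘(ℝ, E) 𝓘(ℝ, F) ∞ φ φ.source)
    (hφ' : ContMDiffOn 𝓘(ℝ, F) 𝓘(ℝ, E) ∞ φ.symm φ.target) {p : N} (hp : p ∈ φ.source)
    (Y : ∀ y : F, TangentSpace 𝓘(ℝ, F) y) :
    ∀ᶠ y in 𝓝 (extChartAt 𝓘(ℝ, E) p p),
      fderiv ℝ (transition φ p) y
        (fieldInChart (VectorField.mpullback 𝓘(ℝ, E) 𝓘(ℝ, F) φ Y : VField E N) p y) =
          Y (transition φ p y) := by
  filter_upwards [eventually_symm_mem_source hp, eventually_fderiv_transition hφ hp] with y hy h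
  rw [h, fieldInChart]
  have h3 := mfderivWithin_extChartAt_symm_comp_mfderiv_extChartAt (I := 𝓘(ℝ, E)) hy.1
  simp only [modelWithCornersSelf_coe, range_id, mfderivWithin_univ] at h3
  set q := (extChartAt 𝓘(ℝ, E) p).symm y with hq
  set V : TangentSpace 𝓘(ℝ, E) q := VectorField.mpullback 𝓘(ℝ, E) 𝓘(ℝ, F) φ Y q with hV
  have h4 := DFunLike.congr_fun h3 V
  refine (congrArg (mfderiv 𝓘(ℝ, E) 𝓘(ℝ, F) φ q) h4).trans ?_
  exact DFunLike.congr_fun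
    (mfderiv_isInvertible hφ hφ' hy.2).self_comp_inverse (Y (φ q))

theorem smoothFieldOn_mpullback [CompleteSpace E] {φ : OpenPartialHomeomorph N F}
    (hφ : ContMDiffOn 𝓘(ℝ, E) 𝓘(ℝ, F) ∞ φ φ.source)
    (hφ' : ContMDiffOn 𝓘(ℝ, F) 𝓘(ℝ, E) ∞ φ.symm φ.target)
    {Y : ∀ y : F, TangentSpace 𝓘(ℝ, F) y} (hY : ContDiff ℝ ∞ (Y : F → F)) :
    SmoothFieldOn (VectorField.mpullback 𝓘(ℝ, E) 𝓘(ℝ, F) φ Y : VField E N) φ.source := by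
  intro q hq
  have hY' : ContMDiffAt 𝓘(ℝ, F) 𝓘(ℝ, F).tangent ∞
      (fun y => (⟨y, Y y⟩ : TangentBundle 𝓘(ℝ, F) F)) (φ q) := by
    rw [contMDiffAt_vectorSpace_iff_contDiffAt]
    exact hY.contDiffAt
  have : IsManifold 𝓘(ℝ, E) 1 N := IsManifold.of_le (n := ∞) (by simp)
  exact (hY'.mpullback_vectorField_preimage (hφ.contMDiffAt (φ.open_source.mem_nhds hq))
    (mfderiv_isInvertible hφ hφ' hq) (by simp)).contMDiffWithinAt

/-- The linear part at a zero of the pullback of a vector field is conjugate, by the derivative of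
the transition map, to the derivative of that field. -/
theorem fderiv_transition_linearPart [CompleteSpace E] {φ : OpenPartialHomeomorph N F}
    (hφ : ContMDiffOn 𝓘(ℝ, E) 𝓘(ℝ, F) ∞ φ φ.source)
    (hφ' : ContMDiffOn 𝓘(ℝ, F) 𝓘(ℝ, E) ∞ φ.symm φ.target) {p : N} (hp : p ∈ φ.source)
    {Y : ∀ y : F, TangentSpace 𝓘(ℝ, F) y} (hY : ContDiff ℝ ∞ (Y : F → F))
    (h0 : Y (φ p) = 0) {L : F →L[ℝ] F} (hL : HasFDerivAt (Y : F → F) L (φ p)) (a : E) :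
    fderiv ℝ (transition φ p) (extChartAt 𝓘(ℝ, E) p p)
      (linearPart (VectorField.mpullback 𝓘(ℝ, E) 𝓘(ℝ, F) φ Y : VField E N) p a) =
    L (fderiv ℝ (transition φ p) (extChartAt 𝓘(ℝ, E) p p) a) := by
  set X : VField E N := VectorField.mpullback 𝓘(ℝ, E) 𝓘(ℝ, F) φ Y with hX
  set y₀ := extChartAt 𝓘(ℝ, E) p p with hy₀
  have hd := differentiableAt_fieldInChart φ.open_source (smoothFieldOn_mpullback hφ hφ' hY) hp
  have hev := eventually_fieldInChart_mpullback hφ hφ' hp Y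
  have hψ := contDiffAt_transition hφ hp
  have hψ' : DifferentiableAt ℝ (fderiv ℝ (transition φ p)) y₀ :=
    (hψ.fderiv_right (m := 1) (by norm_cast)).differentiableAt (by simp)
  have hX0 : fieldInChart X p y₀ = 0 := by
    apply (bijective_fderiv_transition hφ hφ' hp).1
    rw [map_zero]
    refine hev.self_of_nhds.trans ?_
    rw [transition_self]
    exact h0
  have h1 := hψ'.hasFDerivAt.clm_apply hd.hasFDerivAt
  have h2 : HasFDerivAt (fun y => Y (transition φ p y) : E → F)
      (L.comp (fderiv ℝ (transition φ p) y₀)) y₀ := by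
    refine HasFDerivAt.comp y₀ ?_ (hψ.differentiableAt (by simp)).hasFDerivAt
    rwa [transition_self]
  have h3 : fderiv ℝ (transition φ p) y₀ (fderiv ℝ (fieldInChart X p) y₀ a) +
      fderiv ℝ (fderiv ℝ (transition φ p)) y₀ a (fieldInChart X p y₀) =
        L (fderiv ℝ (transition φ p) y₀ a) :=
    DFunLike.congr_fun ((h1.congr_of_eventuallyEq (hev.mono fun y hy => hy.symm)).unique h2) a
  rw [hX0, map_zero, add_zero] at h3
  exact h3

end ChartTransition

/-! ### Reeb vectors and the grading endomorphism -/

section Pointwise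

variable {E : Type*} [NormedAddCommGroup E] [NormedSpace ℝ E]
  {N : Type*} [TopologicalSpace N] [ChartedSpace E N] [IsManifold 𝓘(ℝ, E) ∞ N]
  {K : ContactStructure E N} {p : N}

theorem LocalScale.form_eq_zero_iff (θ : LocalScale K p) {X : TangentSpace 𝓘(ℝ, E) p} :
    θ.form p X = 0 ↔ X ∈ K.plane p := by
  rw [← (θ.mem_fibre p θ.mem_domain).2.1]
  rfl

/-- The exterior derivative of any local contact form is nondegenerate on the contact hyperplane:
it is so for one of them, and the Levi bracket carries this over to the others. -/
theorem LocalScale.eq_zero_of_extD_eq_zero (θ : LocalScale K p) {a : TangentSpace 𝓘(ℝ, E) p}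
    (ha : a ∈ K.plane p) (h : ∀ b ∈ K.plane p, extD θ.form p a b = 0) : a = 0 := by
  obtain ⟨U, α, hU, hp, hs, hα⟩ := K.exists_form p
  let η : LocalScale K p := ⟨U, hU, hp, α, hs, fun q hq => ⟨(hα q hq).1, (hα q hq).2.1,
    fun X hX => by rw [← (hα q hq).2.2.1] at hX; exact hX⟩⟩
  refine (hα p hp).2.2.2 a ha fun b hb => ?_
  have h1 := levi_indep θ η ⟨a, ha⟩ ⟨b, hb⟩
  unfold LocalScale.levi at h1
  rw [h b hb, neg_zero, zero_smul] at h1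
  refine neg_eq_zero.1 ((smul_eq_zero.1 h1.symm).resolve_right fun h2 => ?_)
  have h3 := η.form_eq_zero_iff.2 ((Submodule.Quotient.mk_eq_zero _).1 h2)
  rw [η.exists_eq_one.choose_spec] at h3
  exact one_ne_zero h3

omit [IsManifold 𝓘(ℝ, E) ∞ N] in
theorem IsReebAt.congr {α β : OneForm E N} {R : TangentSpace 𝓘(ℝ, E) p} (h : IsReebAt α p R)
    (h0 : α p = β p) (h1 : formDeriv α p = formDeriv β p) : IsReebAt β p R := by
  unfold IsReebAt extD at *
  rwa [← h0, ← h1]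

theorem IsReebAt.unique {θ : LocalScale K p} {R S : TangentSpace 𝓘(ℝ, E) p}
    (hR : IsReebAt θ.form p R) (hS : IsReebAt θ.form p S) : R = S := by
  refine sub_eq_zero.1 (θ.eq_zero_of_extD_eq_zero (θ.form_eq_zero_iff.1 ?_) fun b _ => ?_)
  · rw [map_sub, hR.1, hS.1, sub_self]
  · rw [sub_eq_add_neg, ← neg_one_smul ℝ S, extD_add_left, extD_smul_left, hR.2, hS.2]
    simp

theorem exists_isReebAt [FiniteDimensional ℝ E] (θ : LocalScale K p) :
    ∃ R, IsReebAt θ.form p R := by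
  have : FiniteDimensional ℝ (TangentSpace 𝓘(ℝ, E) p) := ‹FiniteDimensional ℝ E›
  let B : TangentSpace 𝓘(ℝ, E) p →ₗ[ℝ] Module.Dual ℝ (K.plane p) :=
    LinearMap.mk₂ ℝ (fun a b => extD θ.form p a b) (fun _ _ _ => extD_add_left _ _ _ _ _)
      (fun _ _ _ => extD_smul_left _ _ _ _ _)
      (fun a b b' => by
        rw [extD_swap, Submodule.coe_add, extD_add_left, neg_add, ← extD_swap, ← extD_swap])
      (fun c a b => by
        rw [extD_swap, Submodule.coe_smul, extD_smul_left, ← mul_neg, ← extD_swap, smul_eq_mul])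
  have hinj : Function.Injective (B.comp (K.plane p).subtype) := by
    refine (injective_iff_map_eq_zero _).2 fun a ha => Subtype.ext ?_
    exact θ.eq_zero_of_extD_eq_zero a.2 fun b hb => LinearMap.congr_fun ha ⟨b, hb⟩
  have hsurj := (LinearMap.injective_iff_surjective_of_finrank_eq_finrank
    (Subspace.dual_finrank_eq (K := ℝ) (V := K.plane p)).symm).1 hinj
  obtain ⟨Z, hZ⟩ := θ.exists_eq_one
  -- Correct `Z` by the vector of the hyperplane that represents `dθ(Z, ·)` there.
  obtain ⟨c, hc⟩ := hsurj (B Z)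
  have hR1 : θ.form p (Z - c) = 1 := by
    rw [map_sub, θ.form_eq_zero_iff.2 c.2, hZ, sub_zero]
  have hb : ∀ b ∈ K.plane p, extD θ.form p (Z - c) b = 0 := fun b hb => by
    refine (LinearMap.congr_fun (map_sub B Z c) ⟨b, hb⟩).trans ?_
    exact sub_eq_zero.2 (LinearMap.congr_fun hc ⟨b, hb⟩).symm
  refine ⟨Z - c, hR1, fun Y => ?_⟩
  have hY : Y - θ.form p Y • (Z - c) ∈ K.plane p := by
    rw [← θ.form_eq_zero_iff, map_sub, map_smul, hR1, smul_eq_mul, mul_one, sub_self]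
  have h1 := hb _ hY
  have h2 : extD θ.form p (Z - c) (Z - c) = 0 := sub_self _
  rw [extD_swap, sub_eq_add_neg, ← neg_smul, extD_add_left, extD_smul_left, h2, mul_zero,
    add_zero, ← extD_swap] at h1
  exact h1

theorem isCompl_span_of_form_eq_one {θ : LocalScale K p} {R : TangentSpace 𝓘(ℝ, E) p}
    (hR : θ.form p R = 1) : IsCompl (K.plane p) (Submodule.span ℝ {R}) := by
  constructor
  · rw [Submodule.disjoint_def]
    rintro x hx hx'
    obtain ⟨c, rfl⟩ := Submodule.mem_span_singleton.1 hx'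
    have := θ.form_eq_zero_iff.2 hx
    rw [map_smul, hR, smul_eq_mul, mul_one] at this
    rw [this, zero_smul]
  · rw [codisjoint_iff, eq_top_iff]
    rintro x -
    refine Submodule.mem_sup.2 ⟨x - θ.form p x • R, ?_, θ.form p x • R,
      Submodule.smul_mem _ _ (Submodule.mem_span_singleton_self R), sub_add_cancel _ _⟩
    rw [← θ.form_eq_zero_iff, map_sub, map_smul, hR, smul_eq_mul, mul_one, sub_self]

theorem WeightedJet.gr_injective :
    Function.Injective (WeightedJet.gr : WeightedJet K p → Osc K p →ₗ[ℝ] Osc K p) :=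
  LinearMap.ker_eq_bot.1 (Submodule.ker_liftQ_eq_bot _ _ _ le_rfl)

/-- A field vanishing at `p` whose linear part is the identity on the contact hyperplane and
multiplication by `2` modulo it induces the grading derivation. -/
theorem exists_grField_eq_gradingDerivation {X : VField E N} {U : Set N} (hU : IsOpen U)
    (hpU : p ∈ U) (hX : SmoothFieldOn X U) (h0 : X p = 0)
    (h1 : ∀ a ∈ K.plane p, linearPart X p a = a)
    (h2 : ∀ z, linearPart X p z - (2 : ℝ) • z ∈ K.plane p) :
    ∃ h : X ∈ filteredFields K p,
      grField K p ⟨X, h⟩ = (gradingDerivation K p : Osc K p →ₗ[ℝ] Osc K p) := by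
  refine ⟨⟨⟨U, hU, hpU, hX⟩, h0, fun a ha => by rwa [h1 a ha]⟩, LinearMap.ext fun x => ?_⟩
  refine Prod.ext (Subtype.ext (h1 _ x.1.2)) ?_
  obtain ⟨x, z⟩ := x
  induction z using Submodule.Quotient.induction_on with
  | H z => exact (Submodule.Quotient.eq _).2 (h2 z)

theorem WeightedJet.represents_of_gr_eq {w : WeightedJet K p} {X : VField E N}
    (hw : w.gr = (gradingDerivation K p : Osc K p →ₗ[ℝ] Osc K p))
    (hX : ∃ h : X ∈ filteredFields K p,
      grField K p ⟨X, h⟩ = (gradingDerivation K p : Osc K p →ₗ[ℝ] Osc K p)) :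
    Represents X w := by
  obtain ⟨h, hgr⟩ := hX
  exact ⟨h, WeightedJet.gr_injective (hgr.trans hw.symm)⟩

end Pointwise

/-! ### Vector fields with prescribed linear part -/

section Realization

variable {E : Type*} [NormedAddCommGroup E] [NormedSpace ℝ E] [CompleteSpace E]
  {N : Type*} [TopologicalSpace N] [ChartedSpace E N] [IsManifold 𝓘(ℝ, E) ∞ N]
  {K : ContactStructure E N} {p : N}

/-- Every endomorphism of the tangent space at `p` is the linear part of a smooth vector field
vanishing at `p`. -/
theorem exists_linearPart_eq (p : N) (A : E →L[ℝ] E) :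
    ∃ (X : VField E N) (U : Set N), IsOpen U ∧ p ∈ U ∧ SmoothFieldOn X U ∧ X p = 0 ∧
      ∀ a : E, linearPart X p a = A a := by
  let φ : OpenPartialHomeomorph N E := chartAt E p
  have hφ : ContMDiffOn 𝓘(ℝ, E) 𝓘(ℝ, E) ∞ φ φ.source := contMDiffOn_chart
  have hφ' : ContMDiffOn 𝓘(ℝ, E) 𝓘(ℝ, E) ∞ φ.symm φ.target := contMDiffOn_chart_symm
  have hp : p ∈ φ.source := mem_chart_source E p
  let Y : ∀ y : E, TangentSpace 𝓘(ℝ, E) y := fun y => A (y - φ p)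
  have hY : ContDiff ℝ ∞ (Y : E → E) := A.contDiff.comp (contDiff_id.sub contDiff_const)
  have h0 : Y (φ p) = 0 := (congrArg A (sub_self (φ p))).trans (map_zero A)
  have hL : HasFDerivAt (Y : E → E) A (φ p) := by
    have h := A.hasFDerivAt.comp (φ p) ((hasFDerivAt_id (φ p)).sub_const (φ p))
    rw [ContinuousLinearMap.comp_id] at h
    exact h
  refine ⟨VectorField.mpullback 𝓘(ℝ, E) 𝓘(ℝ, E) φ Y, φ.source, φ.open_source, hp,
    smoothFieldOn_mpullback hφ hφ' hY, ?_, fun a => ?_⟩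
  · rw [VectorField.mpullback_apply, h0, map_zero]
  · have h1 := fderiv_transition_linearPart hφ hφ' hp hY h0 hL a
    have h2 : transition φ p =ᶠ[𝓝 (extChartAt 𝓘(ℝ, E) p p)] id := by
      filter_upwards [extChartAt_target_mem_nhds (I := 𝓘(ℝ, E)) p] with y hy
      exact (extChartAt 𝓘(ℝ, E) p).right_inv hy
    rw [h2.fderiv_eq, fderiv_id] at h1
    exact h1

/-- The dilation with eigenvalue `1` on the contact hyperplane and `2` on the line of `R` is the
linear part of a vector field. -/
theorem exists_dilationField (θ : LocalScale K p) {R : TangentSpace 𝓘(ℝ, E) p}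
    (hR : θ.form p R = 1) :
    ∃ X : VField E N, (∃ h : X ∈ filteredFields K p,
      grField K p ⟨X, h⟩ = (gradingDerivation K p : Osc K p →ₗ[ℝ] Osc K p)) ∧
      Module.End.eigenspace (linearPart X p) 2 = Submodule.span ℝ {R} := by
  let α : E →L[ℝ] ℝ := θ.form p
  let r : E := R
  obtain ⟨X, U, hU, hpU, hX, h0, hlin⟩ :=
    exists_linearPart_eq (N := N) p (ContinuousLinearMap.id ℝ E + α.smulRight r)
  have hlin : ∀ a : TangentSpace 𝓘(ℝ, E) p, linearPart X p a = a + θ.form p a • R := hlin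
  refine ⟨X, exists_grField_eq_gradingDerivation hU hpU hX h0 (fun a ha => ?_) (fun z => ?_), ?_⟩
  · rw [hlin, θ.form_eq_zero_iff.2 ha, zero_smul, add_zero]
  · rw [← θ.form_eq_zero_iff, hlin, map_sub, map_add, map_smul, map_smul, hR, smul_eq_mul,
      smul_eq_mul]
    ring
  · ext z
    rw [Module.End.mem_eigenspace_iff, hlin, two_smul, add_right_inj,
      Submodule.mem_span_singleton]
    refine ⟨fun h => ⟨_, h⟩, ?_⟩
    rintro ⟨c, rfl⟩
    rw [map_smul, hR, smul_eq_mul, mul_one]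

end Realization

/-! ### Contact Darboux charts -/

section Darboux

variable {E : Type*} [NormedAddCommGroup E] [NormedSpace ℝ E]
  {N : Type*} [TopologicalSpace N] [ChartedSpace E N] [IsManifold 𝓘(ℝ, E) ∞ N]
  {K : ContactStructure E N} {p : N} {θ : LocalScale K p} {n : ℕ}
  {φ : OpenPartialHomeomorph N (Coord n)}

/-- The derivative of the Euler field `2 v ∂_v + x^i ∂_{x^i} + p_i ∂_{p_i}`. -/
def eulerLinear (n : ℕ) : Coord n →L[ℝ] Coord n :=
  ((2 : ℝ) • ContinuousLinearMap.fst ℝ ℝ ((Fin n → ℝ) × (Fin n → ℝ))).prod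
    (ContinuousLinearMap.snd ℝ ℝ ((Fin n → ℝ) × (Fin n → ℝ)))

theorem IsDarbouxChart.eventually_formInChart (h : IsDarbouxChart θ φ) :
    ∀ᶠ y in 𝓝 (extChartAt 𝓘(ℝ, E) p p), ∀ w : E,
      formInChart θ.form p y w = (fderiv ℝ (transition φ p) y w).1 +
        ∑ i, (transition φ p y).2.2 i * (fderiv ℝ (transition φ p) y w).2.1 i := by
  filter_upwards [eventually_symm_mem_source h.mem_source,
    eventually_fderiv_transition h.smooth h.mem_source] with y hy hd w
  rw [hd]
  exact h.form_eq _ hy.2 _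

theorem IsDarbouxChart.transition_self (h : IsDarbouxChart θ φ) :
    transition φ p (extChartAt 𝓘(ℝ, E) p p) = 0 :=
  (DilationGerm.transition_self φ p).trans h.map_base

theorem IsDarbouxChart.form_apply (h : IsDarbouxChart θ φ) (w : TangentSpace 𝓘(ℝ, E) p) :
    θ.form p w = (fderiv ℝ (transition φ p) (extChartAt 𝓘(ℝ, E) p p) w).1 := by
  have h1 := h.eventually_formInChart.self_of_nhds w
  rw [h.transition_self] at h1
  refine (formInChart_self θ.form p w).symm.trans (h1.trans ?_)
  simp

/-- The derivative of the Darboux expression of `θ`; the term in the second derivative of the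
coordinates `x^i` drops out because the `p_i` vanish at the centre. -/
theorem IsDarbouxChart.formDeriv_apply (h : IsDarbouxChart θ φ) (a w : E) :
    formDeriv θ.form p a w =
      (fderiv ℝ (fderiv ℝ (transition φ p)) (extChartAt 𝓘(ℝ, E) p p) a w).1 +
        ∑ i, (fderiv ℝ (transition φ p) (extChartAt 𝓘(ℝ, E) p p) a).2.2 i *
          (fderiv ℝ (transition φ p) (extChartAt 𝓘(ℝ, E) p p) w).2.1 i := by
  have hz := h.transition_self
  have hψ := contDiffAt_transition h.smooth h.mem_source
  have hev := h.eventually_formInChart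
  have hF := differentiableAt_formInChart θ.isOpen_domain θ.smooth θ.mem_domain
  unfold formDeriv
  set y₀ := extChartAt 𝓘(ℝ, E) p p
  set ψ : E → Coord n := transition φ p
  have h1 : HasFDerivAt ψ (fderiv ℝ ψ y₀) y₀ := (hψ.differentiableAt (by simp)).hasFDerivAt
  have h2 : HasFDerivAt (fun y => fderiv ℝ ψ y w) ((fderiv ℝ (fderiv ℝ ψ) y₀).flip w) y₀ :=
    ((ContinuousLinearMap.apply ℝ (Coord n) w).hasFDerivAt.comp y₀
      (((hψ.fderiv_right (m := 1) (by norm_cast)).differentiableAt (by simp)).hasFDerivAt))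
  have hF' : HasFDerivAt (fun y => formInChart θ.form p y w)
      ((fderiv ℝ (formInChart θ.form p) y₀).flip w) y₀ :=
    (ContinuousLinearMap.apply ℝ ℝ w).hasFDerivAt.comp y₀ hF.hasFDerivAt
  let P (i : Fin n) : Coord n →L[ℝ] ℝ := (ContinuousLinearMap.proj i).comp
    ((ContinuousLinearMap.snd ℝ _ _).comp (ContinuousLinearMap.snd ℝ _ _))
  let Q (i : Fin n) : Coord n →L[ℝ] ℝ := (ContinuousLinearMap.proj i).comp
    ((ContinuousLinearMap.fst ℝ _ _).comp (ContinuousLinearMap.snd ℝ _ _))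
  have h3 : ∀ i : Fin n, HasFDerivAt (fun y => P i (ψ y) * Q i (fderiv ℝ ψ y w))
      (P i (ψ y₀) • (Q i).comp ((fderiv ℝ (fderiv ℝ ψ) y₀).flip w) +
        Q i (fderiv ℝ ψ y₀ w) • (P i).comp (fderiv ℝ ψ y₀)) y₀ := fun i =>
    ((P i).hasFDerivAt.comp y₀ h1).mul ((Q i).hasFDerivAt.comp y₀ h2)
  have h4 := ((ContinuousLinearMap.fst ℝ ℝ ((Fin n → ℝ) × (Fin n → ℝ))).hasFDerivAt.comp y₀
    h2).add (HasFDerivAt.fun_sum (u := Finset.univ) fun i _ => h3 i)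
  have h5 := DFunLike.congr_fun
    (hF'.unique (h4.congr_of_eventuallyEq (hev.mono fun y hy => hy w))) a
  refine h5.trans ?_
  simp only [hz, map_zero, zero_smul, zero_add, add_apply, ContinuousLinearMap.comp_apply,
    ContinuousLinearMap.flip_apply, sum_apply, smul_apply, smul_eq_mul]
  refine congrArg₂ (· + ·) rfl (Finset.sum_congr rfl fun i _ => mul_comm _ _)

/-- In Darboux coordinates, `dθ = ∑ dp_i ∧ dx^i`. -/
theorem IsDarbouxChart.extD_apply (h : IsDarbouxChart θ φ) (a b : E) :
    extD θ.form p a b =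
      ∑ i, (fderiv ℝ (transition φ p) (extChartAt 𝓘(ℝ, E) p p) a).2.2 i *
          (fderiv ℝ (transition φ p) (extChartAt 𝓘(ℝ, E) p p) b).2.1 i -
      ∑ i, (fderiv ℝ (transition φ p) (extChartAt 𝓘(ℝ, E) p p) b).2.2 i *
          (fderiv ℝ (transition φ p) (extChartAt 𝓘(ℝ, E) p p) a).2.1 i := by
  have hs := ((contDiffAt_transition h.smooth h.mem_source).isSymmSndFDerivAt
    (by rw [minSmoothness_of_isRCLikeNormedField]; norm_cast)) a b
  unfold extD
  rw [h.formDeriv_apply, h.formDeriv_apply, hs]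
  ring

/-- A Darboux chart carries the Reeb vector to `∂_v`. -/
theorem IsDarbouxChart.fderiv_transition_reeb (h : IsDarbouxChart θ φ)
    {R : TangentSpace 𝓘(ℝ, E) p} (hR : IsReebAt θ.form p R) :
    fderiv ℝ (transition φ p) (extChartAt 𝓘(ℝ, E) p p) R = ((1, 0, 0) : Coord n) := by
  have hsurj := (bijective_fderiv_transition h.smooth h.smooth_symm h.mem_source).2
  refine Prod.ext ((h.form_apply R).symm.trans hR.1) (Prod.ext (funext fun i => ?_)
    (funext fun i => ?_))
  -- Pairing with `∂_{p_i}` and `∂_{x^i}` reads off the components of the Reeb vector.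
  · obtain ⟨b, hb⟩ := hsurj ((0, 0, Pi.single i 1) : Coord n)
    have h1 := (h.extD_apply R b).symm.trans (hR.2 b)
    rw [hb] at h1
    simpa [Pi.single_apply] using h1
  · obtain ⟨b, hb⟩ := hsurj ((0, Pi.single i 1, 0) : Coord n)
    have h1 := (h.extD_apply R b).symm.trans (hR.2 b)
    rw [hb] at h1
    simpa [Pi.single_apply] using h1

theorem IsDarbouxChart.grField_chartEuler [CompleteSpace E] (h : IsDarbouxChart θ φ)
    {R : TangentSpace 𝓘(ℝ, E) p} (hR : IsReebAt θ.form p R) :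
    (∃ hX : (chartEuler φ : VField E N) ∈ filteredFields K p,
      grField K p ⟨chartEuler φ, hX⟩ = (gradingDerivation K p : Osc K p →ₗ[ℝ] Osc K p)) ∧
      Module.End.eigenspace (linearPart (chartEuler φ : VField E N) p) 2 =
        Submodule.span ℝ {R} := by
  have hY : ContDiff ℝ ∞ (eulerField n : Coord n → Coord n) := (eulerLinear n).contDiff
  have h0 : eulerField n (φ p) = 0 := by
    rw [h.map_base]
    exact map_zero (eulerLinear n)
  have hinj := (bijective_fderiv_transition h.smooth h.smooth_symm h.mem_source).1
  have hlin := fderiv_transition_linearPart h.smooth h.smooth_symm h.mem_source hY h0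
    (eulerLinear n).hasFDerivAt
  have hform := h.form_apply
  have hBR := h.fderiv_transition_reeb hR
  set B : E →L[ℝ] Coord n := fderiv ℝ (transition φ p) (extChartAt 𝓘(ℝ, E) p p)
  have hlin : ∀ a : E, B (linearPart (chartEuler φ : VField E N) p a) = (2 * (B a).1, (B a).2) :=
    hlin
  have hBsub : ∀ a b : E, B (a - b) = B a - B b := fun a b => map_sub B a b
  have hBsmul : ∀ (c : ℝ) (a : E), B (c • a) = c • B a := fun c a => map_smul B c a
  refine ⟨exists_grField_eq_gradingDerivation φ.open_source h.mem_source
    (smoothFieldOn_mpullback h.smooth h.smooth_symm hY) ?_ (fun a ha => ?_) (fun z => ?_), ?_⟩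
  · rw [chartEuler, VectorField.mpullback_apply, h0, map_zero]
  · apply hinj
    have h1 : (B a).1 = 0 := (hform a).symm.trans (θ.form_eq_zero_iff.2 ha)
    rw [hlin a]
    exact Prod.ext (by rw [h1, mul_zero]) rfl
  · rw [← θ.form_eq_zero_iff, hform]
    refine (congrArg Prod.fst ((hBsub _ _).trans
      (congrArg₂ (· - ·) (hlin z) (hBsmul 2 z)))).trans ?_
    exact sub_self _
  · ext z
    rw [Module.End.mem_eigenspace_iff, Submodule.mem_span_singleton]
    constructor
    · intro hz
      have h1 := (hlin z).symm.trans ((congrArg B hz).trans (hBsmul 2 z))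
      -- The weight-one components satisfy `y = 2 y`.
      have h2 : (B z).2 = 0 := by
        have h3 : (B z).2 = (2 : ℝ) • (B z).2 := congrArg Prod.snd h1
        rw [two_smul] at h3
        exact left_eq_add.1 h3
      refine ⟨(B z).1, hinj ((hBsmul _ R).trans ?_)⟩
      rw [hBR]
      refine Prod.ext (mul_one _) (Eq.trans ?_ h2.symm)
      exact smul_zero _
    · rintro ⟨c, rfl⟩
      apply hinj
      have h1 : B (c • (R : E)) = c • ((1, 0, 0) : Coord n) := (hBsmul c R).trans (by rw [hBR])
      refine (hlin _).trans (Eq.trans ?_ (hBsmul 2 (c • (R : E))).symm)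
      rw [h1]
      refine Prod.ext rfl ?_
      exact ((smul_zero _).trans (smul_zero _).symm : c • (0 : (Fin n → ℝ) × (Fin n → ℝ)) =
        (2 : ℝ) • 0).trans (congrArg _ (smul_zero c).symm)

end Darboux

/-! ### Existence and uniqueness of the dilation germ -/

section Existence

variable {E : Type*} [NormedAddCommGroup E] [NormedSpace ℝ E] [FiniteDimensional ℝ E]
  {N : Type*} [TopologicalSpace N] [ChartedSpace E N] [IsManifold 𝓘(ℝ, E) ∞ N]
  {K : ContactStructure E N} {p : N}

theorem isDilationJet_of_gr_eq (n : ℕ) {θ : LocalScale K p} {w : WeightedJet K p}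
    {R : TangentSpace 𝓘(ℝ, E) p}
    (hw : w.gr = (gradingDerivation K p : Osc K p →ₗ[ℝ] Osc K p)) (hR : IsReebAt θ.form p R) :
    IsDilationJet n θ w R where
  grading := hw
  reeb := hR
  isCompl := isCompl_span_of_form_eq_one hR.1
  realized := by
    have : CompleteSpace E := FiniteDimensional.complete ℝ E
    obtain ⟨X, hX, hX2⟩ := exists_dilationField θ hR.1
    exact ⟨X, WeightedJet.represents_of_gr_eq hw hX, hX2⟩
  darboux φ hφ := by
    have : CompleteSpace E := FiniteDimensional.complete ℝ E
    obtain ⟨hX, hX2⟩ := hφ.grField_chartEuler hR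
    exact ⟨WeightedJet.represents_of_gr_eq hw hX, hX2⟩

theorem exists_isDilationJet (n : ℕ) (θ : LocalScale K p) :
    ∃ (w : WeightedJet K p) (R : TangentSpace 𝓘(ℝ, E) p), IsDilationJet n θ w R := by
  have : CompleteSpace E := FiniteDimensional.complete ℝ E
  obtain ⟨R, hR⟩ := exists_isReebAt θ
  obtain ⟨X, ⟨hX, hgr⟩, -⟩ := exists_dilationField θ hR.1
  exact ⟨(higherFields K p).mkQ ⟨X, hX⟩, R, isDilationJet_of_gr_eq n hgr hR⟩

omit [FiniteDimensional ℝ E] in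
theorem IsDilationJet.unique {n : ℕ} {θ : LocalScale K p} {w w' : WeightedJet K p}
    {R R' : TangentSpace 𝓘(ℝ, E) p} (h : IsDilationJet n θ w R) (h' : IsDilationJet n θ w' R') :
    w = w' ∧ R = R' :=
  ⟨WeightedJet.gr_injective (h.grading.trans h'.grading.symm), h.reeb.unique h'.reeb⟩

/-- The realized dilation germ depends only on the 1-jet of the contact form. -/
theorem IsDilationJet.congr {n : ℕ} {θ η : LocalScale K p} {w : WeightedJet K p}
    {R : TangentSpace 𝓘(ℝ, E) p} (h : IsDilationJet n θ w R) (h0 : θ.form p = η.form p)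
    (h1 : formDeriv θ.form p = formDeriv η.form p) : IsDilationJet n η w R :=
  isDilationJet_of_gr_eq n h.grading (h.reeb.congr h0 h1)

end Existence

end DilationGerm

open DilationGerm in
theorem mainTheorem6 (n : ℕ)
    {E : Type*} [NormedAddCommGroup E] [NormedSpace ℝ E] [FiniteDimensional ℝ E]
    (hdim : Module.finrank ℝ E = 2 * n + 1)
    {N : Type*} [TopologicalSpace N] [ChartedSpace E N] [IsManifold 𝓘(ℝ, E) ∞ N]
    (K : ContactStructure E N) (p : N) :
    ∃ (D : ScaleJet K p → WeightedJet K p) (R : ScaleJet K p → TangentSpace 𝓘(ℝ, E) p),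
      (∀ θ : LocalScale K p, IsDilationJet n θ (D θ.jet) (R θ.jet)) ∧
      (∀ (θ : LocalScale K p) (w : WeightedJet K p) (r : TangentSpace 𝓘(ℝ, E) p),
        IsDilationJet n θ w r → w = D θ.jet ∧ r = R θ.jet) ∧
      (∀ θ η : LocalScale K p,
        θ.form p = η.form p → formDeriv θ.form p = formDeriv η.form p →
          D θ.jet = D η.jet ∧ R θ.jet = R η.jet) := by
  have hex : ∀ j : ScaleJet K p, ∃ (w : WeightedJet K p) (R : TangentSpace 𝓘(ℝ, E) p),
      ∀ θ : LocalScale K p, θ.jet = j → IsDilationJet n θ w R := by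
    intro j
    induction j using Quotient.inductionOn with
    | h η =>
      obtain ⟨w, R, h⟩ := exists_isDilationJet n η
      refine ⟨w, R, fun θ hθ => ?_⟩
      obtain ⟨h0, h1⟩ := Quotient.exact hθ
      exact h.congr h0.symm h1.symm
  choose D R hDR using hex
  refine ⟨D, R, fun θ => hDR _ θ rfl, fun θ w r h => h.unique (hDR _ θ rfl), fun θ η h0 h1 => ?_⟩
  have hj : θ.jet = η.jet := Quotient.sound ⟨h0, h1⟩
  rw [hj]
  exact ⟨rfl, rfl⟩
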